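/- For a positive integer $n$, let $S(n)$ denote the largest real number $a$ such that a (closed) square of edge length $a$ in the Euclidean plane can be covered by $n$ (closed) unit squares, which may be placed in arbitrary position (translated and rotated freely). Then $S(5)=2$; that is, a square of edge length $2$ can be covered by five unit squares, and no square of edge length greater than $2$ can. Furthermore, if $\mathcal{F}$ is a family of five unit squares covering a square $S$ of edge length $2$, then at least one element of $\mathcal{F}$ has sides parallel to those of $S$. -/

import Mathlib

/-- A (closed, solid, nondegenerate) square in the Euclidean plane, in arbitrary position: it is
given by one of its vertices, the two orthonormal directions of the sides that start there, and
its edge length. -/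
structure PlaneSquare where
  /-- a vertex of the square -/
  corner : EuclideanSpace ℝ (Fin 2)
  /-- unit direction of one side starting at `corner` -/
  u : EuclideanSpace ℝ (Fin 2)
  /-- unit direction of the other side starting at `corner` -/
  v : EuclideanSpace ℝ (Fin 2)
  /-- the edge length -/
  side : ℝ
  norm_u : ‖u‖ = 1
  norm_v : ‖v‖ = 1
  inner_u_v : inner ℝ u v = 0
  side_pos : 0 < side

namespace PlaneSquare

/-- The set of points of the square (interior and boundary). -/
def carrier (Q : PlaneSquare) : Set (EuclideanSpace ℝ (Fin 2)) :=
  {p | ∃ x y : ℝ, 0 ≤ x ∧ x ≤ Q.side ∧ 0 ≤ y ∧ y ≤ Q.side ∧ p = Q.corner + x • Q.u + y • Q.v}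

/-- The squares `Q` and `R` have parallel sides: the two directions of the sides of `Q` are, in
some order, the two directions of the sides of `R`, where a direction is the line through the
origin spanned by a vector. -/
def SidesParallel (Q R : PlaneSquare) : Prop :=
  (Submodule.span ℝ {Q.u} = Submodule.span ℝ {R.u} ∧
    Submodule.span ℝ {Q.v} = Submodule.span ℝ {R.v}) ∨
  (Submodule.span ℝ {Q.u} = Submodule.span ℝ {R.v} ∧
    Submodule.span ℝ {Q.v} = Submodule.span ℝ {R.u})

/-- The family `F` consists of unit squares and covers the square `Q`. -/
def IsUnitCover {n : ℕ} (F : Fin n → PlaneSquare) (Q : PlaneSquare) : Prop :=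
  (∀ i, (F i).side = 1) ∧ Q.carrier ⊆ ⋃ i, (F i).carrier

/-- The set of all edge lengths `a` such that a square of edge length `a` can be covered by `n`
unit squares. Its greatest element is the number `S(n)`. -/
def coverableLengths (n : ℕ) : Set ℝ :=
  {a | ∃ Q : PlaneSquare, Q.side = a ∧ ∃ F : Fin n → PlaneSquare, IsUnitCover F Q}

end PlaneSquare

/-! Scale a square of edge at least 2 to `[-1, 1]²`. If the edge exceeds 2, the covering squares
shrink below unit size and fit into tilted unit squares; if it equals 2 and no covering square is
parallel to it, they are tilted already. Both claims thus follow once five tilted unit squares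
cannot cover `[-1, 1]²` (`not_cover_of_tilted`).

No tilted unit square holds two corners, so four of the squares sit at the corners and one, `E`, is
left; since a corner square misses the opposite closed quadrant, `E` holds the centre. Run through
all four sides counterclockwise with a parameter in `[-1, 1]`. On its two sides a corner square
occupies parameters up to `α`, respectively from `β` on, and `α < β` because it cannot cut off two
legs of total length 2. Where consecutive corner squares meet on a side, the `β` of the first is at
most the `α` of the next with indices read along the resulting chain, so the four corner squares
never cover the whole boundary.

`E` cannot reach two opposite sides, and the chain shows that if it were needed on two adjacent
sides it would hold a point of the boundary and its quarter turn, which `Tilted.not_adjacent_sides`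
forbids. This leaves three sides covered by corner squares. Then the points which `E` and one corner
square must contain violate a trigonometric inequality, `no_directions`. -/

/-- A solid unit square none of whose sides is parallel to a coordinate axis. -/
def Tilted (K : ℝ → ℝ → Prop) : Prop :=
  ∃ c s p q : ℝ, 0 < c ∧ 0 < s ∧ c ^ 2 + s ^ 2 = 1 ∧ ∀ x y, K x y ↔
    (p ≤ c * x + s * y ∧ c * x + s * y ≤ p + 1 ∧ q ≤ c * y - s * x ∧ c * y - s * x ≤ q + 1)

/-- The image of a planar set under the counterclockwise quarter turn about the origin. -/
def quarterTurn (K : ℝ → ℝ → Prop) (x y : ℝ) : Prop := K y (-x)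

/-- The image of a planar set under the reflection in the vertical axis. -/
def mirror (K : ℝ → ℝ → Prop) (x y : ℝ) : Prop := K (-x) y

/-- A point of the open first quadrant on the unit circle is given by the tangent of the half
angle. -/
theorem exists_half_tan {c s : ℝ} (hc : 0 < c) (hs : 0 < s) (h : c ^ 2 + s ^ 2 = 1) :
    ∃ t : ℝ, 0 < t ∧ t < 1 ∧ c * (1 + t ^ 2) = 1 - t ^ 2 ∧ s * (1 + t ^ 2) = 2 * t := by
  have hc1 : c < 1 := by nlinarith
  have h1 : 1 - c = s * (s / (1 + c)) := by field_simp; nlinarith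
  have ht : 0 < s / (1 + c) := by positivity
  refine ⟨s / (1 + c), ht, ?_, ?_, ?_⟩
  · rw [div_lt_one (by linarith)]; nlinarith
  · field_simp
    have : s ^ 2 = 1 - c ^ 2 := by linarith
    rw [this]; ring
  · field_simp
    have : s ^ 2 = 1 - c ^ 2 := by linarith
    rw [this]; ring

/-- Adding `c` times `h2` and `c - s` times `h1` eliminates `x` and leaves `s ≤ 2c(1 - c)`.
Multiplied by `1 + c`, this gives `1 + c ≤ 2cs ≤ 1`. -/
theorem corner_legs_aux {c s x : ℝ} (hc : 0 < c) (hs : 0 < s) (h : c ^ 2 + s ^ 2 = 1)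
    (hsc : s ≤ c) (h1 : c * (1 + x) ≤ 1) (h2 : s * (1 + x) + c * (1 - x) ≤ 1) : False := by
  have j1 := mul_le_mul_of_nonneg_left h2 hc.le
  have j2 := mul_le_mul_of_nonneg_left h1 (sub_nonneg.2 hsc)
  have j3 : s ≤ 2 * c * (1 - c) := by linarith
  have j4 := mul_le_mul_of_nonneg_right j3 (by linarith : 0 ≤ 1 + c)
  have j5 : s * (1 + c) ≤ s * (2 * c * s) := by
    have : s ^ 2 = 1 - c ^ 2 := by linarith
    linear_combination j4 - 2 * c * this
  have j6 := le_of_mul_le_mul_left j5 hs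
  linarith [sq_nonneg (c - s)]

/-! ### Metric constraints on a single tilted unit square -/

namespace Tilted

variable {K : ℝ → ℝ → Prop}

theorem quarterTurn (h : Tilted K) : Tilted (quarterTurn K) := by
  obtain ⟨c, s, p, q, hc, hs, hcs, hK⟩ := h
  refine ⟨c, s, -q - 1, p, hc, hs, hcs, fun x y => ?_⟩
  rw [_root_.quarterTurn, hK]
  constructor <;> rintro ⟨h1, h2, h3, h4⟩ <;> refine ⟨?_, ?_, ?_, ?_⟩ <;> linarith

theorem mirror (h : Tilted K) : Tilted (mirror K) := by
  obtain ⟨c, s, p, q, hc, hs, hcs, hK⟩ := h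
  refine ⟨s, c, q, p, hs, hc, by linarith, fun x y => ?_⟩
  rw [_root_.mirror, hK]
  constructor <;> rintro ⟨h1, h2, h3, h4⟩ <;> refine ⟨?_, ?_, ?_, ?_⟩ <;> linarith

/-- The projection to either axis has length `c + s`, and both terms are below 1. Hence no tilted
square meets two opposite sides of `[-1, 1]²`. -/
theorem sub_lt_two (h : Tilted K) {x y x' y' : ℝ} (h1 : K x y) (h2 : K x' y') :
    x' - x < 2 ∧ y' - y < 2 := by
  obtain ⟨c, s, p, q, hc, hs, hcs, hK⟩ := h
  rw [hK] at h1 h2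
  have hc1 : c < 1 := by nlinarith
  have hs1 : s < 1 := by nlinarith
  obtain ⟨a1, a2, a3, a4⟩ := h1
  obtain ⟨b1, b2, b3, b4⟩ := h2
  have e1 : x' - x = c * ((c * x' + s * y') - (c * x + s * y)) -
      s * ((c * y' - s * x') - (c * y - s * x)) := by linear_combination (x - x') * hcs
  have e2 : y' - y = s * ((c * x' + s * y') - (c * x + s * y)) +
      c * ((c * y' - s * x') - (c * y - s * x)) := by linear_combination (y - y') * hcs
  rw [e1, e2]
  constructor <;> nlinarith

/-- A tilted unit square containing a corner of a square of edge length two does not reach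
across the centre. -/
theorem not_corner_and_far_quadrant (h : Tilted K) (h0 : K (-1) (-1)) {x y : ℝ} (hx : 0 ≤ x)
    (hy : 0 ≤ y) : ¬ K x y := by
  intro h1
  obtain ⟨c, s, p, q, hc, hs, hcs, hK⟩ := h
  rw [hK] at h0 h1
  -- The first rotated coordinate grows by at least `c + s > 1`.
  nlinarith [mul_nonneg hc.le hx, mul_nonneg hs.le hy, mul_pos hc hs]

/-- The legs `1 + x` and `1 - x` at the corner have total length 2. Reflection in the diagonal swaps
`c` with `s` and `x` with `-x`, so `s ≤ c` may be assumed. -/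
theorem not_corner_and_legs (h : Tilted K) (h0 : K (-1) (-1)) {x : ℝ}
    (h1 : K x (-1)) : ¬ K (-1) (-x) := by
  intro h2
  obtain ⟨c, s, p, q, hc, hs, hcs, hK⟩ := h
  rw [hK] at h0 h1 h2
  have i1 : c * (1 + x) ≤ 1 := by linarith
  have i2 : s * (1 - x) ≤ 1 := by linarith
  have i3 : s * (1 + x) + c * (1 - x) ≤ 1 := by linarith
  rcases le_total s c with hsc | hsc
  · exact corner_legs_aux hc hs hcs hsc i1 i3
  · exact corner_legs_aux hs hc (by linarith) hsc (x := -x) (by linarith) (by linarith)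

/-- The two points are a quarter turn apart about the origin, at distance `√(2(1 + x²))`. A unit
square has diameter `√2`, so `x = 0` and the points span a diagonal; this makes the square parallel
to the axes. -/
theorem not_adjacent_sides (h : Tilted K) {x : ℝ} (h1 : K 1 x) :
    ¬ K (-x) 1 := by
  intro h2
  obtain ⟨c, s, p, q, hc, hs, hcs, hK⟩ := h
  rw [hK] at h1 h2
  have i1 : ((c + s * x) - (s - c * x)) ^ 2 ≤ 1 := by
    rw [sq_le_one_iff_abs_le_one, abs_le]; constructor <;> linarith
  have i2 : ((c + s * x) + (s - c * x)) ^ 2 ≤ 1 := by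
    rw [sq_le_one_iff_abs_le_one, abs_le]; constructor <;> linarith
  have e : (c + s * x) ^ 2 + (s - c * x) ^ 2 = 1 + x ^ 2 := by
    linear_combination (1 + x ^ 2) * hcs
  have e' : ((c + s * x) - (s - c * x)) ^ 2 + ((c + s * x) + (s - c * x)) ^ 2 =
      2 * (1 + x ^ 2) := by linear_combination 2 * e
  have hx : x = 0 := by
    have : x ^ 2 ≤ 0 := by linarith
    exact pow_eq_zero_iff two_ne_zero |>.1 (le_antisymm this (sq_nonneg x))
  subst hx
  linarith [mul_pos hc hs]

/-- A tilted unit square that contains a unit segment does not reach the parallel line at unit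
distance over that segment. -/
theorem not_unit_base_and_height (h : Tilted K) (h0 : K (-1) (-1)) (h1 : K 0 (-1)) (x : ℝ) :
    ¬ K x 0 := by
  intro h2
  obtain ⟨c, s, p, q, hc, hs, hcs, hK⟩ := h
  rw [hK] at h0 h1 h2
  have hc1 : c < 1 := by nlinarith
  have hs1 : s < 1 := by nlinarith
  -- Eliminating `x` from these two bounds gives `(1 - c)(1 - s) ≤ 0`.
  have i1 : c * (x + 1) ≤ 1 - s := by linarith
  have i2 : c + s - 1 ≤ s * (x + 1) := by linarith
  nlinarith [mul_pos (sub_pos.2 hc1) (sub_pos.2 hs1), mul_le_mul_of_nonneg_left i1 hs.le,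
    mul_le_mul_of_nonneg_left i2 hc.le]

theorem isClosed_affine (h : Tilted K) (a b a' b' : ℝ) :
    IsClosed {t : ℝ | K (a + b * t) (a' + b' * t)} := by
  obtain ⟨c, s, p, q, hc, hs, hcs, hK⟩ := h
  simp only [hK, Set.ofPred_and]
  refine IsClosed.inter (isClosed_le (by fun_prop) (by fun_prop)) (IsClosed.inter
    (isClosed_le (by fun_prop) (by fun_prop)) (IsClosed.inter
    (isClosed_le (by fun_prop) (by fun_prop)) (isClosed_le (by fun_prop) (by fun_prop))))

theorem ordConnected_affine (h : Tilted K) (a b a' b' : ℝ) :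
    {t : ℝ | K (a + b * t) (a' + b' * t)}.OrdConnected := by
  obtain ⟨c, s, p, q, hc, hs, hcs, hK⟩ := h
  refine Convex.ordConnected ?_
  intro x hx y hy m n hm hn hmn
  simp only [Set.mem_ofPred_eq, hK, smul_eq_mul] at *
  obtain rfl : n = 1 - m := by linarith
  obtain ⟨a1, a2, a3, a4⟩ := hx
  obtain ⟨b1, b2, b3, b4⟩ := hy
  refine ⟨?_, ?_, ?_, ?_⟩ <;> nlinarith

/-- Along a segment that starts in a tilted square there is a last point of the square. -/
theorem exists_last (h : Tilted K) {P : ℝ → Prop} (a b a' b' : ℝ)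
    (hP : ∀ t, P t ↔ K (a + b * t) (a' + b' * t)) (h1 : P (-1)) :
    ∃ α, -1 ≤ α ∧ α ≤ 1 ∧ ∀ x, -1 ≤ x → x ≤ 1 → (P x ↔ x ≤ α) := by
  have hcl := h.isClosed_affine a b a' b'
  have hoc := h.ordConnected_affine a b a' b'
  simp only [← hP] at hcl hoc
  obtain ⟨α, ⟨⟨hα, hα'⟩, hα2⟩, hmax⟩ := (isCompact_Icc.inter_right hcl : IsCompact
    (Set.Icc (-1 : ℝ) 1 ∩ {t | P t})).exists_isGreatest ⟨-1, by simp, h1⟩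
  exact ⟨α, hα, hα', fun x hx hx' => ⟨fun hp => hmax ⟨⟨hx, hx'⟩, hp⟩,
    fun hxα => hoc.out h1 hα2 ⟨hx, hxα⟩⟩⟩

/-- Along a segment that ends in a tilted square there is a first point of the square. -/
theorem exists_first (h : Tilted K) {P : ℝ → Prop} (a b a' b' : ℝ)
    (hP : ∀ t, P t ↔ K (a + b * t) (a' + b' * t)) (h1 : P 1) :
    ∃ β, -1 ≤ β ∧ β ≤ 1 ∧ ∀ x, -1 ≤ x → x ≤ 1 → (P x ↔ β ≤ x) := by
  obtain ⟨α, h2, h3, h4⟩ := h.exists_last (P := fun t => P (-t)) a (-b) a' (-b')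
    (fun t => by rw [hP]; ring_nf) (by simpa using h1)
  refine ⟨-α, by linarith, by linarith, fun x hx hx' => ?_⟩
  have := h4 (-x) (by linarith) (by linarith)
  rw [neg_neg] at this
  rw [this, neg_le]

/-- The property of lying in a tilted square passes to the ends of an open segment. -/
theorem ends_of_Ioo (h : Tilted K) {P : ℝ → Prop} (a b a' b' : ℝ)
    (hP : ∀ t, P t ↔ K (a + b * t) (a' + b' * t)) {l r : ℝ} (hlr : l < r)
    (h1 : ∀ t, l < t → t < r → P t) : P l ∧ P r := by
  have hcl := h.isClosed_affine a b a' b'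
  simp only [← hP] at hcl
  have hsub : closure (Set.Ioo l r) ⊆ {t | P t} :=
    closure_minimal (fun t ht => h1 t ht.1 ht.2) hcl
  rw [closure_Ioo hlr.ne] at hsub
  exact ⟨hsub (Set.left_mem_Icc.2 hlr.le), hsub (Set.right_mem_Icc.2 hlr.le)⟩

end Tilted

/-! ### Corner covers and the traces of their squares on the boundary -/

/-- Four tilted unit squares at the corners of the square `[-1, 1]²` and a fifth one that together
cover it. -/
structure CornerCover (SE NE NW SW E : ℝ → ℝ → Prop) : Prop where
  tse : Tilted SE
  tne : Tilted NE
  tnw : Tilted NW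
  tsw : Tilted SW
  te : Tilted E
  se : SE 1 (-1)
  ne : NE 1 1
  nw : NW (-1) 1
  sw : SW (-1) (-1)
  cover : ∀ x y, -1 ≤ x → x ≤ 1 → -1 ≤ y → y ≤ 1 → SE x y ∨ NE x y ∨ NW x y ∨ SW x y ∨ E x y

theorem not_se_corner_and_nw {K : ℝ → ℝ → Prop} (h : Tilted K) {x y : ℝ} (h0 : K 1 (-1))
    (hx : x ≤ 0) (hy : 0 ≤ y) : ¬ K x y := by
  have := h.mirror.not_corner_and_far_quadrant (by simpa [mirror] using h0)
    (x := -x) (by linarith) hy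
  simpa [mirror] using this

theorem not_ne_corner_and_sw {K : ℝ → ℝ → Prop} (h : Tilted K) {x y : ℝ} (h0 : K 1 1)
    (hx : x ≤ 0) (hy : y ≤ 0) : ¬ K x y := by
  have := h.quarterTurn.quarterTurn.not_corner_and_far_quadrant (by simpa [quarterTurn] using h0)
    (x := -x) (y := -y) (by linarith) (by linarith)
  simpa [quarterTurn] using this

namespace CornerCover

variable {SE NE NW SW E : ℝ → ℝ → Prop}

theorem quarterTurn (h : CornerCover SE NE NW SW E) :
    CornerCover (quarterTurn SW) (quarterTurn SE) (quarterTurn NE) (quarterTurn NW)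
      (quarterTurn E) where
  tse := h.tsw.quarterTurn
  tne := h.tse.quarterTurn
  tnw := h.tne.quarterTurn
  tsw := h.tnw.quarterTurn
  te := h.te.quarterTurn
  se := h.sw
  ne := h.se
  nw := by simpa [_root_.quarterTurn] using h.ne
  sw := by simpa [_root_.quarterTurn] using h.nw
  cover x y h1 h2 h3 h4 := by
    have := h.cover y (-x) h3 h4 (by linarith) (by linarith)
    simp only [_root_.quarterTurn]; tauto

theorem mirror (h : CornerCover SE NE NW SW E) :
    CornerCover (mirror SW) (mirror NW) (mirror NE) (mirror SE) (mirror E) where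
  tse := h.tsw.mirror
  tne := h.tnw.mirror
  tnw := h.tne.mirror
  tsw := h.tse.mirror
  te := h.te.mirror
  se := h.sw
  ne := h.nw
  nw := by simpa [_root_.mirror] using h.ne
  sw := by simpa [_root_.mirror] using h.se
  cover x y h1 h2 h3 h4 := by
    have := h.cover (-x) y (by linarith) (by linarith) h3 h4
    simp only [_root_.mirror]; tauto

theorem center (h : CornerCover SE NE NW SW E) : E 0 0 := by
  have h1 := h.tsw.not_corner_and_far_quadrant h.sw le_rfl le_rfl
  have h2 := not_se_corner_and_nw h.tse h.se le_rfl le_rfl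
  have h3 := not_ne_corner_and_sw h.tne h.ne le_rfl le_rfl
  have h4 := h.tnw.quarterTurn.not_corner_and_far_quadrant
    (by simpa [_root_.quarterTurn] using h.nw) le_rfl le_rfl
  simp only [_root_.quarterTurn, neg_zero] at h4
  have := h.cover 0 0 (by norm_num) (by norm_num) (by norm_num) (by norm_num)
  tauto

/-- The two western corner squares are too narrow to reach this side. Quarter turns give the other
sides, with the parameter always running counterclockwise. -/
theorem east (h : CornerCover SE NE NW SW E) {x : ℝ} (hx : -1 ≤ x) (hx' : x ≤ 1) :
    SE 1 x ∨ NE 1 x ∨ E 1 x := by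
  have h1 : ¬ SW 1 x := fun hh => by linarith [(h.tsw.sub_lt_two h.sw hh).1]
  have h2 : ¬ NW 1 x := fun hh => by linarith [(h.tnw.sub_lt_two h.nw hh).1]
  have := h.cover 1 x (by norm_num) le_rfl hx hx'
  tauto

theorem south (h : CornerCover SE NE NW SW E) {x : ℝ} (hx : -1 ≤ x) (hx' : x ≤ 1) :
    SW x (-1) ∨ SE x (-1) ∨ E x (-1) :=
  h.quarterTurn.east hx hx'

theorem west (h : CornerCover SE NE NW SW E) {x : ℝ} (hx : -1 ≤ x) (hx' : x ≤ 1) :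
    NW (-1) (-x) ∨ SW (-1) (-x) ∨ E (-1) (-x) :=
  h.quarterTurn.quarterTurn.east hx hx'

theorem north (h : CornerCover SE NE NW SW E) {x : ℝ} (hx : -1 ≤ x) (hx' : x ≤ 1) :
    NE (-x) 1 ∨ NW (-x) 1 ∨ E (-x) 1 := by
  simpa [_root_.quarterTurn] using h.quarterTurn.quarterTurn.quarterTurn.east hx hx'

/-- As a point `x` moves from `-1` to `1`, the corner square `SW` first contains `(x, -1)`, then
neither of `(x, -1)` and `(-1, -x)`, then `(-1, -x)`. -/
theorem thresholds_sw (h : CornerCover SE NE NW SW E) : ∃ α β, α < β ∧ -1 ≤ α ∧ β ≤ 1 ∧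
    ∀ x, -1 ≤ x → x ≤ 1 → (SW x (-1) ↔ x ≤ α) ∧ (SW (-1) (-x) ↔ β ≤ x) := by
  obtain ⟨α, h1, h2, h3⟩ := h.tsw.exists_last (P := fun x => SW x (-1)) 0 1 (-1) 0
    (fun t => by norm_num) h.sw
  obtain ⟨β, h4, h5, h6⟩ := h.tsw.exists_first (P := fun x => SW (-1) (-x)) (-1) 0 0 (-1)
    (fun t => by norm_num) h.sw
  refine ⟨α, β, ?_, h1, h5, fun x hx hx' => ⟨h3 x hx hx', h6 x hx hx'⟩⟩
  -- If `β ≤ α`, the parameter `α` yields two legs of total length 2.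
  by_contra! hle
  exact h.tsw.not_corner_and_legs h.sw ((h3 α h1 h2).2 le_rfl) ((h6 α h1 h2).2 hle)

theorem thresholds_se (h : CornerCover SE NE NW SW E) : ∃ α β, α < β ∧ -1 ≤ α ∧ β ≤ 1 ∧
    ∀ x, -1 ≤ x → x ≤ 1 → (SE 1 x ↔ x ≤ α) ∧ (SE x (-1) ↔ β ≤ x) := by
  simpa [_root_.quarterTurn] using h.quarterTurn.quarterTurn.quarterTurn.thresholds_sw

theorem thresholds_ne (h : CornerCover SE NE NW SW E) : ∃ α β, α < β ∧ -1 ≤ α ∧ β ≤ 1 ∧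
    ∀ x, -1 ≤ x → x ≤ 1 → (NE (-x) 1 ↔ x ≤ α) ∧ (NE 1 x ↔ β ≤ x) := by
  simpa [_root_.quarterTurn] using h.quarterTurn.quarterTurn.thresholds_sw

theorem thresholds_nw (h : CornerCover SE NE NW SW E) : ∃ α β, α < β ∧ -1 ≤ α ∧ β ≤ 1 ∧
    ∀ x, -1 ≤ x → x ≤ 1 → (NW (-1) (-x) ↔ x ≤ α) ∧ (NW (-x) 1 ↔ β ≤ x) := by
  simpa [_root_.quarterTurn] using h.quarterTurn.thresholds_sw

end CornerCover

/-! ### The trigonometric inequality -/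

/-- With `α` eliminated, the difference of the two sides is a convex quadratic in `v`, so it
suffices to control it at the ends of an interval containing `v`; the products `hend` bound `v²` by
the chord. -/
theorem half_tan_quadratic_neg {τ v α : ℝ} (hτ : 0 < τ) (hτ1 : τ < 1) (hα : 0 < α)
    (hv : v = 1 - τ - α) (hv0 : 0 < v) (h1 : α * (1 - τ ^ 2) ≤ 2 * τ ^ 2) :
    (1 + v) * ((1 - τ) ^ 2 - 2 * α * τ) ≤ 2 * v * (1 - τ ^ 2) := by
  by_contra! hlt
  obtain rfl : α = 1 - τ - v := by linarith
  have hquad : 0 < (1 - τ) * (1 - 3 * τ) + v * (-1 - 2 * τ + 5 * τ ^ 2) + 2 * τ * v ^ 2 := by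
    linarith
  rcases le_total τ (1 / 3) with h3 | h3
  · have hv1 : 1 - 7 / 4 * τ ≤ v := by nlinarith
    have hv2 : v ≤ 1 - τ := by linarith
    have hend : (1 - τ - v) * (v - (1 - 7 / 4 * τ)) ≥ 0 :=
      mul_nonneg (by linarith) (by linarith)
    nlinarith [mul_nonneg hτ.le hend, mul_nonneg hτ.le hτ.le]
  -- This factor is `(1 - τ)² - 2ατ`; its zero in `v` serves as the lower end of the interval.
  · have hfac : 0 < (1 - τ) * (1 - 3 * τ) + 2 * τ * v := by
      by_contra! hle
      have h4 : (1 + v) * ((1 - τ) * (1 - 3 * τ) + 2 * τ * v) ≤ 0 :=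
        mul_nonpos_of_nonneg_of_nonpos (by linarith) hle
      have h5 : 0 ≤ 2 * v * (1 - τ ^ 2) := by
        have : 0 < 1 - τ ^ 2 := by nlinarith
        positivity
      linarith
    have hend : 0 < ((1 - τ) * (1 - 3 * τ) + 2 * τ * v) * (1 - τ - v) :=
      mul_pos hfac (by linarith)
    nlinarith

/-- The trigonometric inequality that excludes the last configuration; `(c, s)` and `(C, S)` are
the directions of the sides of the two squares that meet the upper left quarter. -/
theorem no_directions {c s C S α β : ℝ} (hc : 0 < c) (hs : 0 < s) (hcs : c ^ 2 + s ^ 2 = 1)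
    (hC : 0 < C) (hS : 0 < S) (hCS : C ^ 2 + S ^ 2 = 1) (hα : 0 < α) (hβ : β ≤ 1)
    (h1 : (1 + α) * c ≤ 1) (h2 : (1 + α) * s + (1 - β) * c ≤ 1) (h3 : S * β + C ≤ 1)
    (h4 : ∀ t, s * t = 1 - c → C * (1 - t - α) + S < 1) : False := by
  -- In half-angle tangents, with the roles of `C` and `S` exchanged for `u`, all hypotheses become
  -- rational, and the `t` of `h4` is `τ`.
  obtain ⟨τ, hτ, hτ1, ec, es⟩ := exists_half_tan hc hs hcs
  obtain ⟨u, hu, hu1, eS, eC⟩ := exists_half_tan hS hC (by linarith)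
  have hτ2 : 0 < 1 + τ ^ 2 := by positivity
  have hu2 : 0 < 1 + u ^ 2 := by positivity
  have hτ3 : 0 < 1 - τ ^ 2 := by nlinarith
  have hst : s * τ = 1 - c := by
    apply mul_right_cancel₀ hτ2.ne'
    linear_combination τ * es + ec
  have huv : 1 - τ - α < u := by
    have := mul_lt_mul_of_pos_right (h4 τ hst) hu2
    have h5 : u * (1 - τ - α) < u * u := by
      linear_combination this / 2 - (1 - τ - α) / 2 * eC - eS / 2
    exact lt_of_mul_lt_mul_left h5 hu.le
  have hβu : 2 * u ≤ (1 - β) * (1 + u) := by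
    have := mul_le_mul_of_nonneg_right h3 hu2.le
    have h5 : (1 - u) * (2 * u) ≤ (1 - u) * ((1 - β) * (1 + u)) := by
      linear_combination this - β * eS - eC
    exact le_of_mul_le_mul_left h5 (by linarith)
  have hβτ : (1 - β) * (1 - τ ^ 2) ≤ (1 - τ) ^ 2 - 2 * α * τ := by
    have := mul_le_mul_of_nonneg_right h2 hτ2.le
    linear_combination this - (1 + α) * es - (1 - β) * ec
  have hατ : α * (1 - τ ^ 2) ≤ 2 * τ ^ 2 := by
    have := mul_le_mul_of_nonneg_right h1 hτ2.le
    linear_combination this - (1 + α) * ec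
  -- If `α ≥ 1 - τ`, then `hβτ` forces `τ ≤ 1/3` while `hατ` forces `τ ≥ 1/2`.
  rcases le_or_gt (1 - τ - α) 0 with hv | hv
  · have h5 : 0 ≤ (1 - β) * (1 - τ ^ 2) := mul_nonneg (by linarith) hτ3.le
    have h6 : 0 ≤ (1 - τ) * (1 - 3 * τ) := by nlinarith
    have h7 : 0 ≤ 1 - 3 * τ := nonneg_of_mul_nonneg_right h6 (by linarith)
    have h8 : (1 - τ) * (1 - τ ^ 2) ≤ 2 * τ ^ 2 := by nlinarith
    have h9 : 2 / 3 * (1 - τ ^ 2) ≤ (1 - τ) * (1 - τ ^ 2) :=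
      mul_le_mul_of_nonneg_right (by linarith) hτ3.le
    nlinarith
  · have h5 := half_tan_quadratic_neg hτ hτ1 hα rfl hv hατ
    generalize 1 - τ - α = v at *
    have h6 := mul_le_mul_of_nonneg_left hβτ (by linarith : 0 ≤ 1 + v)
    -- Now `2u/(1 + u) ≤ 1 - β ≤ 2v/(1 + v)`, contrary to `v < u` since `z ↦ 2z/(1 + z)` increases.
    have h7 : (1 + v) * (1 - β) ≤ 2 * v := by
      refine le_of_mul_le_mul_right ?_ hτ3
      linarith
    have h8 := mul_le_mul_of_nonneg_right h7 (by linarith : 0 ≤ 1 + u)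
    have h9 := mul_le_mul_of_nonneg_right hβu (by linarith : 0 ≤ 1 + v)
    linarith

/-! ### Excluding corner covers -/

namespace CornerCover

variable {SE NE NW SW E : ℝ → ℝ → Prop}

/-- A corner cover in which only the upper side needs the fifth square cannot exist, provided the
midpoint of the lower side belongs to the lower left square. -/
theorem false_of_sw (h : CornerCover SE NE NW SW E)
    (hE : ∀ x, -1 ≤ x → x ≤ 1 → SE 1 x ∨ NE 1 x)
    (hS : ∀ x, -1 ≤ x → x ≤ 1 → SW x (-1) ∨ SE x (-1))
    (hW : ∀ x, -1 ≤ x → x ≤ 1 → NW (-1) x ∨ SW (-1) x) (h0 : SW 0 (-1)) : False := by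
  obtain ⟨α₀, β₀, l₀, m₀, n₀, t₀⟩ := h.thresholds_se
  obtain ⟨α₁, β₁, l₁, m₁, n₁, t₁⟩ := h.thresholds_ne
  obtain ⟨α₂, β₂, l₂, m₂, n₂, t₂⟩ := h.thresholds_nw
  obtain ⟨α₃, β₃, l₃, m₃, n₃, t₃⟩ := h.thresholds_sw
  have g₀ : β₁ ≤ α₀ := by
    by_contra! hlt
    obtain ⟨x, hx, hx'⟩ := exists_between hlt
    have i1 : -1 ≤ x := by linarith
    have i2 : x ≤ 1 := by linarith
    rcases hE x i1 i2 with hh | hh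
    · linarith [(t₀ x i1 i2).1.1 hh]
    · linarith [(t₁ x i1 i2).2.1 hh]
  have g₃ : β₀ ≤ α₃ := by
    by_contra! hlt
    obtain ⟨x, hx, hx'⟩ := exists_between hlt
    have i1 : -1 ≤ x := by linarith
    have i2 : x ≤ 1 := by linarith
    rcases hS x i1 i2 with hh | hh
    · linarith [(t₃ x i1 i2).1.1 hh]
    · linarith [(t₀ x i1 i2).2.1 hh]
  have g₂ : β₃ ≤ α₂ := by
    by_contra! hlt
    obtain ⟨x, hx, hx'⟩ := exists_between hlt
    have i1 : -1 ≤ x := by linarith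
    have i2 : x ≤ 1 := by linarith
    rcases hW (-x) (by linarith) (by linarith) with hh | hh
    · linarith [(t₂ x i1 i2).1.1 hh]
    · linarith [(t₃ x i1 i2).2.1 hh]
  have hα₃ : 0 ≤ α₃ := (t₃ 0 (by norm_num) (by norm_num)).1.1 h0
  -- The chain `α₁ < β₁ ≤ α₀ < β₀ ≤ α₃ < β₃ ≤ α₂ < β₂` leaves a gap on the upper side, and gives `0
  -- < α₂` and `α₁ < α₂`.
  have hnorth : ∀ x, α₁ < x → x < β₂ → E (-x) 1 := by
    intro x hx hx'
    have i1 : -1 ≤ x := by linarith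
    have i2 : x ≤ 1 := by linarith
    rcases h.north i1 i2 with hh | hh | hh
    · linarith [(t₁ x i1 i2).1.1 hh]
    · linarith [(t₂ x i1 i2).2.1 hh]
    · exact hh
  obtain ⟨e₁, e₂⟩ := h.te.ends_of_Ioo (P := fun x => E (-x) 1) 0 (-1) 1 0
    (fun t => by norm_num) (by linarith : α₁ < β₂) hnorth
  have k1 : NW (-1) (-α₂) := (t₂ α₂ (by linarith) (by linarith)).1.2 le_rfl
  have k2 : NW (-β₂) 1 := (t₂ β₂ (by linarith) (by linarith)).2.2 le_rfl
  have k3 := h.nw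
  obtain ⟨c, s, p, q, hc, hs, hcs, hK⟩ := h.tnw
  -- On the horizontal midline `NW` reaches at most `t = (1 - c)/s` from the left side, and `SW`,
  -- which contains a unit base, does not reach that line at all. So `E` takes over from there to
  -- the centre.
  have hmid : ∀ t, s * t = 1 - c → E (-1 + t) 0 := by
    intro t ht
    have hc1 : c < 1 := by nlinarith
    have hs1 : s < 1 := by nlinarith
    have ht0 : 0 < t := pos_of_mul_pos_right (by linarith : 0 < s * t) hs.le
    have ht1 : t < 1 := by
      have : s * t < s * 1 := by nlinarith [mul_pos hc hs]
      exact lt_of_mul_lt_mul_left this hs.le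
    refine (h.te.ends_of_Ioo (P := fun x => E x 0) 0 1 0 0 (fun t => by norm_num)
      (by linarith : -1 + t < 0) fun x hx hx' => ?_).1
    have i1 := not_se_corner_and_nw h.tse h.se hx'.le le_rfl
    have i2 := not_ne_corner_and_sw h.tne h.ne hx'.le le_rfl
    have i3 := h.tsw.not_unit_base_and_height h.sw h0 x
    have i4 : ¬ NW x 0 := by
      intro hh
      rw [hK] at hh k3
      have := mul_lt_mul_of_pos_left (by linarith : t < x + 1) hs
      linarith
    have := h.cover x 0 (by linarith) (by linarith) (by norm_num) (by norm_num)
    tauto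
  rw [hK] at k1 k2 k3
  have k4 := h.center
  obtain ⟨C, S, P, Q, hC, hS, hCS, hK'⟩ := h.te
  simp only [hK'] at e₁ e₂ k4 hmid
  refine no_directions (α := α₂) (β := β₂) hc hs hcs hC hS hCS (by linarith) n₂ (by linarith)
    (by linarith) (by linarith) fun t ht => ?_
  have := hmid t ht
  have := mul_lt_mul_of_pos_left (by linarith : α₁ < α₂) hC
  linarith

theorem false_of_three_sides (h : CornerCover SE NE NW SW E)
    (hE : ∀ x, -1 ≤ x → x ≤ 1 → SE 1 x ∨ NE 1 x)
    (hS : ∀ x, -1 ≤ x → x ≤ 1 → SW x (-1) ∨ SE x (-1))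
    (hW : ∀ x, -1 ≤ x → x ≤ 1 → NW (-1) x ∨ SW (-1) x) : False := by
  rcases hS 0 (by norm_num) (by norm_num) with h0 | h0
  · exact h.false_of_sw hE hS hW h0
  · refine h.mirror.false_of_sw (fun x hx hx' => (hW x hx hx').symm)
      (fun x hx hx' => (hS (-x) (by linarith) (by linarith)).symm)
      (fun x hx hx' => ?_) (by simpa [_root_.mirror] using h0)
    simpa [_root_.mirror] using (hE x hx hx').symm

/-- If the upper side needs the fifth square, then the lower side does not. -/
theorem south_of_north (h : CornerCover SE NE NW SW E) {x : ℝ} (h1 : E x 1) :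
    ∀ x, -1 ≤ x → x ≤ 1 → SW x (-1) ∨ SE x (-1) := by
  intro x' hx hx'
  have : ¬ E x' (-1) := fun hh => by linarith [(h.te.sub_lt_two hh h1).2]
  have := h.south hx hx'
  tauto

/-- The fifth square is not needed on two adjacent sides. -/
theorem not_north_and_east (h : CornerCover SE NE NW SW E)
    (hS : ∀ x, -1 ≤ x → x ≤ 1 → SW x (-1) ∨ SE x (-1))
    (hW : ∀ x, -1 ≤ x → x ≤ 1 → NW (-1) x ∨ SW (-1) x) {a b : ℝ}
    (ha : -1 ≤ a) (ha' : a ≤ 1) (hb : -1 ≤ b) (hb' : b ≤ 1)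
    (hN : ¬ NE (-a) 1 ∧ ¬ NW (-a) 1) (hE : ¬ SE 1 b ∧ ¬ NE 1 b) : False := by
  obtain ⟨α₀, β₀, l₀, m₀, n₀, t₀⟩ := h.thresholds_se
  obtain ⟨α₁, β₁, l₁, m₁, n₁, t₁⟩ := h.thresholds_ne
  obtain ⟨α₂, β₂, l₂, m₂, n₂, t₂⟩ := h.thresholds_nw
  obtain ⟨α₃, β₃, l₃, m₃, n₃, t₃⟩ := h.thresholds_sw
  rw [(t₁ a ha ha').1, (t₂ a ha ha').2] at hN
  rw [(t₀ b hb hb').1, (t₁ b hb hb').2] at hE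
  have g₃ : β₀ ≤ α₃ := by
    by_contra! hlt
    obtain ⟨x, hx, hx'⟩ := exists_between hlt
    have i1 : -1 ≤ x := by linarith
    have i2 : x ≤ 1 := by linarith
    rcases hS x i1 i2 with hh | hh
    · linarith [(t₃ x i1 i2).1.1 hh]
    · linarith [(t₀ x i1 i2).2.1 hh]
  have g₂ : β₃ ≤ α₂ := by
    by_contra! hlt
    obtain ⟨x, hx, hx'⟩ := exists_between hlt
    have i1 : -1 ≤ x := by linarith
    have i2 : x ≤ 1 := by linarith
    rcases hW (-x) (by linarith) (by linarith) with hh | hh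
    · linarith [(t₂ x i1 i2).1.1 hh]
    · linarith [(t₃ x i1 i2).2.1 hh]
  -- Only `α₀ < β₂` needs the chain `α₀ < β₀ ≤ α₃ < β₃ ≤ α₂ < β₂`; a common parameter of the two
  -- gaps follows.
  have hlt : max α₀ α₁ < min β₁ β₂ := by
    simp only [max_lt_iff, lt_min_iff]
    refine ⟨⟨?_, ?_⟩, ?_, ?_⟩ <;> linarith
  obtain ⟨x, hx, hx'⟩ := exists_between hlt
  simp only [max_lt_iff, lt_min_iff] at hx hx'
  have i1 : -1 ≤ x := by linarith
  have i2 : x ≤ 1 := by linarith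
  have j1 : E 1 x := by
    rcases h.east i1 i2 with hh | hh | hh
    · linarith [(t₀ x i1 i2).1.1 hh]
    · linarith [(t₁ x i1 i2).2.1 hh]
    · exact hh
  have j2 : E (-x) 1 := by
    rcases h.north i1 i2 with hh | hh | hh
    · linarith [(t₁ x i1 i2).1.1 hh]
    · linarith [(t₂ x i1 i2).2.1 hh]
    · exact hh
  exact h.te.not_adjacent_sides j1 j2

/-- The upper side does not need the fifth square. -/
theorem north_covered (h : CornerCover SE NE NW SW E) {a : ℝ} (ha : -1 ≤ a) (ha' : a ≤ 1) :
    NE (-a) 1 ∨ NW (-a) 1 := by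
  by_contra! hN
  have hEN : E (-a) 1 := by
    have := h.north ha ha'
    tauto
  have hS := h.south_of_north hEN
  have hWE : (∀ x, -1 ≤ x → x ≤ 1 → SE 1 x ∨ NE 1 x) ∨
      ∀ x, -1 ≤ x → x ≤ 1 → NW (-1) x ∨ SW (-1) x := by
    by_contra! hh
    obtain ⟨⟨b, hb, hb', hb1, hb2⟩, b', hc, hc', hc1, hc2⟩ := hh
    have k1 := h.east hb hb'
    have k2 := h.west (x := -b') (by linarith) (by linarith)
    rw [neg_neg] at k2
    have k3 : E 1 b := by tauto
    have k4 : E (-1) b' := by tauto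
    linarith [(h.te.sub_lt_two k4 k3).1]
  rcases hWE with hE | hW
  · refine h.false_of_three_sides hE hS fun b hb hb' => ?_
    by_contra! hW
    refine h.mirror.not_north_and_east (a := -a) (b := b)
      (fun x hx hx' => (hS (-x) (by linarith) (by linarith)).symm)
      (fun x hx hx' => ?_) (by linarith) (by linarith) hb hb' ?_ ⟨hW.2, hW.1⟩
    · simpa [_root_.mirror] using (hE x hx hx').symm
    · simpa [_root_.mirror] using hN.symm
  · refine h.false_of_three_sides (fun b hb hb' => ?_) hS hW
    by_contra! hE
    exact h.not_north_and_east hS hW ha ha' hb hb' hN hE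

theorem false (h : CornerCover SE NE NW SW E) : False := by
  refine h.false_of_three_sides (fun x hx hx' => ?_) (fun x hx hx' => ?_) fun x hx hx' => ?_
  · exact h.quarterTurn.north_covered (a := x) hx hx' |>.imp
      (by simp [_root_.quarterTurn]) (by simp [_root_.quarterTurn])
  · exact h.quarterTurn.quarterTurn.north_covered (a := x) hx hx' |>.imp
      (by simp [_root_.quarterTurn]) (by simp [_root_.quarterTurn])
  · exact h.quarterTurn.quarterTurn.quarterTurn.north_covered (a := -x) (by linarith) (by linarith) |>.imp
      (by simp [_root_.quarterTurn]) (by simp [_root_.quarterTurn])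

end CornerCover

/-- Five tilted unit squares do not cover the square `[-1, 1]²`. -/
theorem not_cover_of_tilted (K : Fin 5 → ℝ → ℝ → Prop) (hK : ∀ i, Tilted (K i))
    (h : ∀ x y, -1 ≤ x → x ≤ 1 → -1 ≤ y → y ≤ 1 → ∃ i, K i x y) : False := by
  obtain ⟨a, ha⟩ := h 1 (-1) (by norm_num) le_rfl le_rfl (by norm_num)
  obtain ⟨b, hb⟩ := h 1 1 (by norm_num) le_rfl (by norm_num) le_rfl
  obtain ⟨c, hc⟩ := h (-1) 1 le_rfl (by norm_num) (by norm_num) le_rfl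
  obtain ⟨d, hd⟩ := h (-1) (-1) le_rfl (by norm_num) le_rfl (by norm_num)
  have hne : ∀ {i j : Fin 5} {x y x' y' : ℝ}, K i x y → K j x' y' →
      2 ≤ x' - x ∨ 2 ≤ y' - y → i ≠ j := by
    rintro i j x y x' y' h1 h2 h3 rfl
    have := (hK i).sub_lt_two h1 h2
    rcases h3 with h3 | h3 <;> linarith
  have hab := hne ha hb (by norm_num)
  have hca := hne hc ha (by norm_num)
  have hda := hne hd ha (by norm_num)
  have hcb := hne hc hb (by norm_num)
  have hdb := hne hd hb (by norm_num)
  have hdc := hne hd hc (by norm_num)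
  obtain ⟨e, he⟩ : ∃ e : Fin 5, ∀ i, i = a ∨ i = b ∨ i = c ∨ i = d ∨ i = e := by
    clear ha hb hc hd hne
    decide +revert
  refine CornerCover.false (SE := K a) (NE := K b) (NW := K c) (SW := K d) (E := K e)
    ⟨hK a, hK b, hK c, hK d, hK e, ha, hb, hc, hd, fun x y h1 h2 h3 h4 => ?_⟩
  obtain ⟨i, hi⟩ := h x y h1 h2 h3 h4
  rcases he i with rfl | rfl | rfl | rfl | rfl <;> tauto

/-! ### Enclosing squares in tilted unit squares -/

theorem min_zero_le_mul_le {A x : ℝ} (hx : 0 ≤ x) (hx' : x ≤ 1) :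
    min 0 A ≤ x * A ∧ x * A ≤ min 0 A + |A| := by
  rcases le_total 0 A with h | h
  · rw [min_eq_left h, abs_of_nonneg h]
    constructor <;> nlinarith
  · rw [min_eq_right h, abs_of_nonpos h]
    constructor <;> nlinarith

/-- Both rotated coordinates of the given square range over intervals of length `|cm + sn| + |cn -
sm|`, whose lower ends locate the enclosing square. -/
theorem exists_tilted_of_width {c s m n d x₀ y₀ : ℝ} (hc : 0 < c) (hs : 0 < s)
    (hcs : c ^ 2 + s ^ 2 = 1) (hd : |d| = 1) (hw : |c * m + s * n| + |c * n - s * m| ≤ 1) :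
    ∃ K, Tilted K ∧ ∀ x y, 0 ≤ x → x ≤ 1 → 0 ≤ y → y ≤ 1 →
      K (x₀ + (x * m + y * (-n * d))) (y₀ + (x * n + y * (m * d))) := by
  have e1 : |-(c * n - s * m) * d| = |c * n - s * m| := by rw [abs_mul, hd, abs_neg, mul_one]
  have e2 : |(c * m + s * n) * d| = |c * m + s * n| := by rw [abs_mul, hd, mul_one]
  refine ⟨_, ⟨c, s, c * x₀ + s * y₀ + (min 0 (c * m + s * n) + min 0 (-(c * n - s * m) * d)),
    c * y₀ - s * x₀ + (min 0 (c * n - s * m) + min 0 ((c * m + s * n) * d)), hc, hs, hcs,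
    fun x y => Iff.rfl⟩, fun x y h1 h2 h3 h4 => ?_⟩
  have i1 := min_zero_le_mul_le (A := c * m + s * n) h1 h2
  have i2 := min_zero_le_mul_le (A := -(c * n - s * m) * d) h3 h4
  have i3 := min_zero_le_mul_le (A := c * n - s * m) h1 h2
  have i4 := min_zero_le_mul_le (A := (c * m + s * n) * d) h3 h4
  rw [e1] at i2
  rw [e2] at i4
  refine ⟨?_, ?_, ?_, ?_⟩ <;> linarith

/-- Every square of edge length `r ≤ 1` lies in a tilted unit square, provided that `r < 1` or that
the square is not parallel to the coordinate axes. -/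
theorem exists_tilted {m n d r x₀ y₀ : ℝ} (hmn : m ^ 2 + n ^ 2 = 1) (hd : |d| = 1) (hr : 0 < r)
    (hr1 : r ≤ 1) (h : r < 1 ∨ m ≠ 0 ∧ n ≠ 0) :
    ∃ K, Tilted K ∧ ∀ x y, 0 ≤ x → x ≤ 1 → 0 ≤ y → y ≤ 1 →
      K (x₀ + (x * (r * m) + y * (-(r * n) * d))) (y₀ + (x * (r * n) + y * ((r * m) * d))) := by
  suffices hw : ∃ c s, 0 < c ∧ 0 < s ∧ c ^ 2 + s ^ 2 = 1 ∧
      |c * (r * m) + s * (r * n)| + |c * (r * n) - s * (r * m)| ≤ 1 by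
    obtain ⟨c, s, hc, hs, hcs, hw⟩ := hw
    exact exists_tilted_of_width hc hs hcs hd hw
  have key : ∀ c s, r * (|c * m + s * n| + |c * n - s * m|) ≤ 1 →
      |c * (r * m) + s * (r * n)| + |c * (r * n) - s * (r * m)| ≤ 1 := by
    intro c s hle
    rwa [show c * (r * m) + s * (r * n) = r * (c * m + s * n) by ring,
      show c * (r * n) - s * (r * m) = r * (c * n - s * m) by ring, abs_mul, abs_mul,
      abs_of_pos hr, ← mul_add]
  by_cases hmn0 : m ≠ 0 ∧ n ≠ 0
  · obtain ⟨hm, hn⟩ := hmn0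
    have hab : |m| ^ 2 + |n| ^ 2 = 1 := by simpa using hmn
    have h1 : |m| * |m| + |n| * |n| = 1 := by linarith
    -- The square keeps its own directions; the sign of `mn` tells which side points into the open
    -- first quadrant up to sign.
    rcases lt_or_gt_of_ne (mul_ne_zero hm hn) with hlt | hgt
    · refine ⟨|n|, |m|, abs_pos.2 hn, abs_pos.2 hm, by linarith, key _ _ ?_⟩
      have hab' : |m| * n = -(|n| * m) := by
        rcases mul_neg_iff.1 hlt with ⟨h2, h3⟩ | ⟨h2, h3⟩
        · rw [abs_of_pos h2, abs_of_neg h3]; ring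
        · rw [abs_of_neg h2, abs_of_pos h3]; ring
      rw [show |n| * m + |m| * n = 0 by rw [hab']; ring, abs_zero, zero_add]
      have : |(|n| * n - |m| * m)| ≤ 1 := by
        refine (abs_sub _ _).trans ?_
        simp only [abs_mul, abs_abs]; linarith
      exact mul_le_one₀ hr1 (abs_nonneg _) this
    · refine ⟨|m|, |n|, abs_pos.2 hm, abs_pos.2 hn, hab, key _ _ ?_⟩
      have hab' : |m| * n = |n| * m := by
        rcases mul_pos_iff.1 hgt with ⟨h2, h3⟩ | ⟨h2, h3⟩
        · rw [abs_of_pos h2, abs_of_pos h3]; ring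
        · rw [abs_of_neg h2, abs_of_neg h3]; ring
      rw [show |m| * n - |n| * m = 0 by rw [hab']; ring, abs_zero, add_zero]
      have : |(|m| * m + |n| * n)| ≤ 1 := by
        refine (abs_add_le _ _).trans ?_
        simp only [abs_mul, abs_abs]; linarith
      exact mul_le_one₀ hr1 (abs_nonneg _) this
  · have hlt : r < 1 := h.resolve_right hmn0
    -- A small rotation uses up the slack: with half-angle tangent `t` and `r = 1 - 2t`, `r(c + s) ≤
    -- 1` reads `1 - 5t² + 2t³ ≤ 1 + t²`.
    set t := (1 - r) / 2 with ht
    have ht0 : 0 < t := by rw [ht]; linarith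
    have ht1 : t < 1 := by rw [ht]; linarith
    have hpos : 0 < 1 + t ^ 2 := by positivity
    have hsum : r * ((1 - t ^ 2) / (1 + t ^ 2) + 2 * t / (1 + t ^ 2)) ≤ 1 := by
      rw [← add_div, ← mul_div_assoc, div_le_one hpos]
      nlinarith
    have hc : 0 < (1 - t ^ 2) / (1 + t ^ 2) := div_pos (by nlinarith) hpos
    have hs : 0 < 2 * t / (1 + t ^ 2) := by positivity
    refine ⟨(1 - t ^ 2) / (1 + t ^ 2), 2 * t / (1 + t ^ 2), hc, hs, by field_simp; ring,
      key _ _ (le_trans ?_ hsum)⟩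
    refine mul_le_mul_of_nonneg_left (le_of_eq ?_) hr.le
    have hmn' : m = 0 ∨ n = 0 := by tauto
    rcases hmn' with rfl | rfl
    · have : |n| = 1 := by rw [← sq_eq_sq₀ (abs_nonneg _) zero_le_one]; simpa using hmn
      simp [abs_mul, this, abs_of_pos hc, abs_of_pos hs, add_comm]
    · have : |m| = 1 := by rw [← sq_eq_sq₀ (abs_nonneg _) zero_le_one]; simpa using hmn
      simp [abs_mul, this, abs_of_pos hc, abs_of_pos hs]

/-! ### Coordinates relative to the covered square -/

namespace PlaneSquare

theorem coord_u (Q : PlaneSquare) : Q.u 0 ^ 2 + Q.u 1 ^ 2 = 1 := by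
  have := Q.norm_u
  rw [← sq_eq_sq₀ (norm_nonneg _) zero_le_one, EuclideanSpace.real_norm_sq_eq] at this
  simpa [Fin.sum_univ_two] using this

/-- The sign `d` is the determinant of the frame, whose orientation is not fixed. -/
theorem coord_v (Q : PlaneSquare) : ∃ d : ℝ, d ^ 2 = 1 ∧ Q.v 0 = -Q.u 1 * d ∧ Q.v 1 = Q.u 0 * d := by
  have h1 := Q.coord_u
  have h2 := Q.norm_v
  rw [← sq_eq_sq₀ (norm_nonneg _) zero_le_one, EuclideanSpace.real_norm_sq_eq] at h2
  simp only [Fin.sum_univ_two] at h2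
  have h3 := Q.inner_u_v
  simp only [PiLp.inner_apply, Fin.sum_univ_two, RCLike.inner_apply, conj_trivial] at h3
  refine ⟨Q.u 0 * Q.v 1 - Q.u 1 * Q.v 0, ?_, ?_, ?_⟩
  · linear_combination (Q.u 0 ^ 2 + Q.u 1 ^ 2) * h2 + h1 -
      (Q.v 0 * Q.u 0 + Q.v 1 * Q.u 1) * h3
  · linear_combination -Q.v 0 * h1 + Q.u 0 * h3
  · linear_combination -Q.v 1 * h1 + Q.u 1 * h3

/-- The expansion of a vector in the orthonormal basis given by the sides of a square. -/
theorem expand (Q : PlaneSquare) (w : EuclideanSpace ℝ (Fin 2)) :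
    w = inner ℝ w Q.u • Q.u + inner ℝ w Q.v • Q.v := by
  have h1 := Q.coord_u
  obtain ⟨d, hd, h2, h3⟩ := Q.coord_v
  ext i
  simp only [PiLp.inner_apply, Fin.sum_univ_two, RCLike.inner_apply, conj_trivial, PiLp.add_apply,
    PiLp.smul_apply, smul_eq_mul, h2, h3]
  fin_cases i
  · simp only [Fin.zero_eta, h2]
    linear_combination -w 0 * h1 + (-w 0 * Q.u 1 ^ 2 + w 1 * Q.u 0 * Q.u 1) * hd
  · simp only [Fin.mk_one, h3]
    linear_combination -w 1 * h1 + (-w 1 * Q.u 0 ^ 2 + w 0 * Q.u 0 * Q.u 1) * hd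

theorem inner_expand (Q : PlaneSquare) (w w' : EuclideanSpace ℝ (Fin 2)) :
    inner ℝ w w' = inner ℝ w Q.u * inner ℝ w' Q.u + inner ℝ w Q.v * inner ℝ w' Q.v := by
  conv_lhs => rw [Q.expand w', inner_add_right, inner_smul_right, inner_smul_right]
  ring

theorem span_smul_eq {m : ℝ} (hm : m ≠ 0) (w : EuclideanSpace ℝ (Fin 2)) :
    Submodule.span ℝ {m • w} = Submodule.span ℝ {w} :=
  Submodule.span_singleton_smul_eq (IsUnit.mk0 m hm) w

/-- The coordinates of the sides of a square `G` in the frame of a square `Q`. -/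
theorem relative_coord (G Q : PlaneSquare) : ∃ m n d : ℝ, m ^ 2 + n ^ 2 = 1 ∧ |d| = 1 ∧
    G.u = m • Q.u + n • Q.v ∧ G.v = (-n * d) • Q.u + (m * d) • Q.v ∧
    (¬ G.SidesParallel Q → m ≠ 0 ∧ n ≠ 0) := by
  have e1 := Q.expand G.u
  have e2 := Q.expand G.v
  have h1 := Q.inner_expand G.u G.u
  have h2 := Q.inner_expand G.v G.v
  have h3 := Q.inner_expand G.u G.v
  rw [real_inner_self_eq_norm_sq, G.norm_u] at h1
  rw [real_inner_self_eq_norm_sq, G.norm_v] at h2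
  rw [G.inner_u_v] at h3
  generalize (inner ℝ G.u Q.u : ℝ) = m at *
  generalize (inner ℝ G.u Q.v : ℝ) = n at *
  generalize (inner ℝ G.v Q.u : ℝ) = m' at *
  generalize (inner ℝ G.v Q.v : ℝ) = n' at *
  have f1 : m' = -n * (m * n' - n * m') := by linear_combination m' * h1 - m * h3
  have f2 : n' = m * (m * n' - n * m') := by linear_combination n' * h1 - n * h3
  have hd : (m * n' - n * m') ^ 2 = 1 := by
    linear_combination (-(m' ^ 2 + n' ^ 2)) * h1 - h2 + (m * m' + n * n') * h3
  refine ⟨m, n, m * n' - n * m', by linarith, ?_, e1, by rw [← f1, ← f2]; exact e2,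
    fun hp => ⟨?_, ?_⟩⟩
  · rw [← sq_eq_sq₀ (abs_nonneg _) zero_le_one, sq_abs, hd, one_pow]
  · rintro rfl
    have hn : n ≠ 0 := by rintro rfl; norm_num at h1
    have hn' : n' = 0 := by linarith
    have hm' : m' ≠ 0 := by rintro rfl; subst hn'; norm_num at h2
    subst hn'
    rw [zero_smul, zero_add] at e1
    rw [zero_smul, add_zero] at e2
    exact hp (Or.inr ⟨by rw [e1, span_smul_eq hn], by rw [e2, span_smul_eq hm']⟩)
  · rintro rfl
    have hm : m ≠ 0 := by rintro rfl; norm_num at h1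
    have hm' : m' = 0 := by linarith
    have hn' : n' ≠ 0 := by rintro rfl; subst hm'; norm_num at h2
    subst hm'
    rw [zero_smul, add_zero] at e1
    rw [zero_smul, zero_add] at e2
    exact hp (Or.inl ⟨by rw [e1, span_smul_eq hm], by rw [e2, span_smul_eq hn']⟩)

theorem inner_frame (Q : PlaneSquare) (x y : ℝ) :
    inner ℝ (x • Q.u + y • Q.v) Q.u = x ∧ inner ℝ (x • Q.u + y • Q.v) Q.v = y := by
  have h : inner ℝ Q.v Q.u = 0 := by rw [real_inner_comm]; exact Q.inner_u_v
  simp [inner_add_left, inner_smul_left, Q.inner_u_v, h, Q.norm_u, Q.norm_v]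

/-- In the coordinates of a square `Q` of edge length at least two, scaled so that `Q` becomes
`[-1, 1]²`, a unit square `G` lies in a tilted unit square, unless `Q` has edge length two and `G`
is parallel to it. -/
theorem exists_tilted_relative (G Q : PlaneSquare) (hG : G.side = 1) (hQ : 2 ≤ Q.side)
    (h : 2 < Q.side ∨ ¬ G.SidesParallel Q) :
    ∃ K, Tilted K ∧ ∀ x y : ℝ, Q.corner + (Q.side / 2 * (x + 1)) • Q.u +
      (Q.side / 2 * (y + 1)) • Q.v ∈ G.carrier → K x y := by
  obtain ⟨m, n, d, hmn, hd, hu, hv, hp⟩ := G.relative_coord Q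
  have ha := Q.side_pos
  have hr1 : 2 / Q.side ≤ 1 := by rwa [div_le_one ha]
  have hr : 2 / Q.side < 1 ∨ m ≠ 0 ∧ n ≠ 0 := h.imp (fun h => by rwa [div_lt_one ha]) hp
  obtain ⟨K, hK, hKc⟩ := exists_tilted
    (x₀ := 2 / Q.side * inner ℝ (G.corner - Q.corner) Q.u - 1)
    (y₀ := 2 / Q.side * inner ℝ (G.corner - Q.corner) Q.v - 1) hmn hd (by positivity) hr1 hr
  refine ⟨K, hK, fun x y hxy => ?_⟩
  obtain ⟨a, b, h1, h2, h3, h4, hab⟩ := hxy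
  rw [hG] at h2 h4
  convert hKc a b h1 h2 h3 h4 using 1
  all_goals
    have e : (Q.side / 2 * (x + 1)) • Q.u + (Q.side / 2 * (y + 1)) • Q.v =
        (G.corner - Q.corner) + ((a * m + b * (-n * d)) • Q.u + (a * n + b * (m * d)) • Q.v) := by
      rw [← add_right_inj Q.corner, ← add_assoc, hab, hu, hv]
      module
  · have := congrArg (fun w => inner ℝ w Q.u) e
    simp only [(Q.inner_frame _ _).1, inner_add_left (G.corner - Q.corner)] at this
    field_simp
    linear_combination 2 * this
  · have := congrArg (fun w => inner ℝ w Q.v) e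
    simp only [(Q.inner_frame _ _).2, inner_add_left (G.corner - Q.corner)] at this
    field_simp
    linear_combination 2 * this

theorem not_isUnitCover (Q : PlaneSquare) (F : Fin 5 → PlaneSquare) (hQ : 2 ≤ Q.side)
    (h : 2 < Q.side ∨ ∀ i, ¬ (F i).SidesParallel Q) : ¬ IsUnitCover F Q := by
  rintro ⟨h1, hcov⟩
  choose K hK hKc using fun i => exists_tilted_relative (F i) Q (h1 i) hQ (h.imp_right fun h => h i)
  have ha := Q.side_pos
  refine not_cover_of_tilted K hK fun x y hx hx' hy hy' => ?_
  have hmem : Q.corner + (Q.side / 2 * (x + 1)) • Q.u + (Q.side / 2 * (y + 1)) • Q.v ∈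
      Q.carrier :=
    ⟨_, _, mul_nonneg (by linarith) (by linarith), by nlinarith,
      mul_nonneg (by linarith) (by linarith), by nlinarith, rfl⟩
  obtain ⟨i, hi⟩ := Set.mem_iUnion.1 (hcov hmem)
  exact ⟨i, hKc i x y hi⟩

/-! ### The cover of a square of edge two -/

/-- The square with sides parallel to the axes and given lower left vertex. -/
noncomputable def axisSquare (x y a : ℝ) (ha : 0 < a) : PlaneSquare where
  corner := !₂[x, y]
  u := !₂[1, 0]
  v := !₂[0, 1]
  side := a
  norm_u := by simp [EuclideanSpace.norm_eq, Fin.sum_univ_two]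
  norm_v := by simp [EuclideanSpace.norm_eq, Fin.sum_univ_two]
  inner_u_v := by simp [PiLp.inner_apply, Fin.sum_univ_two]
  side_pos := ha

theorem mem_axisSquare {x y a : ℝ} {ha : 0 < a} {p : EuclideanSpace ℝ (Fin 2)} :
    p ∈ (axisSquare x y a ha).carrier ↔ (x ≤ p 0 ∧ p 0 ≤ x + a) ∧ y ≤ p 1 ∧ p 1 ≤ y + a := by
  constructor
  · rintro ⟨s, t, h1, h2, h3, h4, rfl⟩
    simp only [axisSquare] at *
    simp
    exact ⟨⟨h1, h2⟩, h3, h4⟩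
  · rintro ⟨⟨h1, h2⟩, h3, h4⟩
    refine ⟨p 0 - x, p 1 - y, by linarith, by simp only [axisSquare]; linarith, by linarith,
      by simp only [axisSquare]; linarith, ?_⟩
    ext i
    fin_cases i <;> simp [axisSquare]

theorem two_mem_coverableLengths : 2 ∈ coverableLengths 5 := by
  refine ⟨axisSquare 0 0 2 two_pos, rfl, ![axisSquare 0 0 1 one_pos, axisSquare 0 1 1 one_pos,
    axisSquare 1 0 1 one_pos, axisSquare 1 1 1 one_pos, axisSquare 0 0 1 one_pos], ?_, ?_⟩
  · intro i
    fin_cases i <;> rfl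
  · intro p hp
    rw [mem_axisSquare] at hp
    obtain ⟨⟨h1, h2⟩, h3, h4⟩ := hp
    rw [Set.mem_iUnion]
    rcases le_total (p 0) 1 with h5 | h5 <;> rcases le_total (p 1) 1 with h6 | h6
    · exact ⟨0, mem_axisSquare.2 ⟨⟨h1, by linarith⟩, h3, by linarith⟩⟩
    · exact ⟨1, mem_axisSquare.2 ⟨⟨h1, by linarith⟩, h6, by linarith⟩⟩
    · exact ⟨2, mem_axisSquare.2 ⟨⟨h5, by linarith⟩, h3, by linarith⟩⟩
    · exact ⟨3, mem_axisSquare.2 ⟨⟨h5, by linarith⟩, h6, by linarith⟩⟩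

end PlaneSquare

theorem theorem2 :
    IsGreatest (PlaneSquare.coverableLengths 5) 2 ∧
    ∀ (Q : PlaneSquare) (F : Fin 5 → PlaneSquare), Q.side = 2 → PlaneSquare.IsUnitCover F Q →
      ∃ i, PlaneSquare.SidesParallel (F i) Q := by
  refine ⟨⟨PlaneSquare.two_mem_coverableLengths, ?_⟩, ?_⟩
  · rintro a ⟨Q, rfl, F, hF⟩
    by_contra! hlt
    exact Q.not_isUnitCover F hlt.le (Or.inl hlt) hF
  · intro Q F hQ hF
    by_contra! hp
    exact Q.not_isUnitCover F hQ.ge (Or.inr hp) hF
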